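/- Let $M$ be a Riemann surface (a connected Hausdorff complex manifold of complex dimension one) that is not homeomorphic to $S^2$, let $\mathbb{CP}^2$ carry its standard complex structure and the Fubini–Study metric, and let $\pi : S^5 \to \mathbb{CP}^2$, $u \mapsto [u]$, be the Hopf fibration on the unit sphere $S^5 \subset \mathbb{C}^3$. Let $f : M \to \mathbb{CP}^2$ be a smooth immersion without complex points, that is, its Kähler angle $\theta : M \to [0,\pi]$ (given by $\cos\theta = \Omega(df\,e_1, df\,e_2)/\mathrm{area}(df\,e_1, df\,e_2)$ for a positively oriented basis $e_1, e_2$ of the tangent space, where $\Omega$ is the Kähler form and $\mathrm{area}$ is the area of the parallelogram spanned) never takes the values $0$ and $\pi$; equivalently, no $df(T_pM)$ is a complex line of $T_{f(p)}\mathbb{CP}^2$. A global lift of a smooth immersion $h : N \to \mathbb{CP}^2$ of a Riemann surface $N$ is a smooth immersion $\mathfrak{h} : N \to S^5$ with $\pi \circ \mathfrak{h} = h$. Then either $f$ has a global lift $\mathfrak{f} : M \to S^5$, or there exist a Riemann surface $\hat M$ and a $3$-fold covering $\tau : \hat M \to M$ (a holomorphic covering map all of whose fibres have exactly three points) such that $\hat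 f = f \circ \tau : \hat M \to \mathbb{CP}^2$ is an immersion that has a global lift $\hat M \to S^5$, while $f$ itself has no global lift. -/

import Mathlib

open scoped Manifold ContDiff

universe u

noncomputable section

/-- Complex Euclidean plane `ℂ²`, the model space of `ℂP²`. -/
abbrev C2 : Type := EuclideanSpace ℂ (Fin 2)

/-- `ℂ³` with its standard Hermitian inner product. -/
abbrev C3 : Type := EuclideanSpace ℂ (Fin 3)

/-! ### The complex projective plane as a complex manifold -/

/-- The complex projective plane: the complex lines through the origin of `ℂ³`. -/
def CP2 : Type := Projectivization ℂ C3

namespace CP2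

/-- The point `[Z]` with homogeneous coordinates `Z`. -/
def mk (Z : {Z : C3 // Z ≠ 0}) : CP2 := Projectivization.mk' ℂ Z

/-- The quotient topology of `ℂ³ ∖ {0}`. -/
instance : TopologicalSpace CP2 := TopologicalSpace.coinduced mk inferInstance

theorem isQuotientMap_mk : Topology.IsQuotientMap mk :=
  ⟨⟨rfl⟩, Quotient.mk_surjective⟩

theorem mk_eq_mk (Z W : {Z : C3 // Z ≠ 0}) :
    mk Z = mk W ↔ ∃ t : ℂ, t • (W : C3) = Z :=
  Projectivization.mk_eq_mk_iff' ℂ _ _ Z.2 W.2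

/-- A function of homogeneous coordinates that is invariant under scaling. -/
def lift {α : Type*} (F : {Z : C3 // Z ≠ 0} → α)
    (hF : ∀ (Z W : {Z : C3 // Z ≠ 0}) (t : ℂ), (Z : C3) = t • (W : C3) → F Z = F W) :
    CP2 → α :=
  Projectivization.lift F hF

@[simp] theorem lift_mk {α : Type*} (F : {Z : C3 // Z ≠ 0} → α)
    (hF : ∀ (Z W : {Z : C3 // Z ≠ 0}) (t : ℂ), (Z : C3) = t • (W : C3) → F Z = F W)
    (Z : {Z : C3 // Z ≠ 0}) : lift F hF (mk Z) = F Z := rfl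

theorem scale_ne_zero {Z W : {Z : C3 // Z ≠ 0}} {t : ℂ} (h : (Z : C3) = t • (W : C3)) :
    t ≠ 0 := by
  rintro rfl
  exact Z.2 (by simpa using h)

/-- The affine domain `{[Z] | Zᵢ ≠ 0}`. -/
def affineDomain (i : Fin 3) : Set CP2 :=
  {q | lift (fun Z => (Z : C3) i ≠ 0) (fun Z W t h => by
    have ht := scale_ne_zero h
    simp [h, ht]) q}

@[simp] theorem mk_mem_affineDomain (i : Fin 3) (Z : {Z : C3 // Z ≠ 0}) :
    mk Z ∈ affineDomain i ↔ (Z : C3) i ≠ 0 := Iff.rfl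

/-- The affine coordinates `[Z] ↦ (Z_j / Z_i)_{j ≠ i}`. -/
def affineCoord (i : Fin 3) : CP2 → C2 :=
  lift (fun Z => WithLp.toLp 2 fun j => (Z : C3) (i.succAbove j) / (Z : C3) i)
    (fun Z W t h => by
      have ht := scale_ne_zero h
      ext j
      simp [h, mul_div_mul_left _ _ ht])

@[simp] theorem affineCoord_mk (i : Fin 3) (Z : {Z : C3 // Z ≠ 0}) (j : Fin 2) :
    affineCoord i (mk Z) j = (Z : C3) (i.succAbove j) / (Z : C3) i := rfl

/-- The vector of `ℂ³` with `i`-th entry `a` and remaining entries `w`, in order. -/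
def insertCoord (i : Fin 3) (a : ℂ) (w : C2) : C3 :=
  WithLp.toLp 2 (i.insertNth (α := fun _ => ℂ) a w)

@[simp] theorem insertCoord_same (i : Fin 3) (a : ℂ) (w : C2) : insertCoord i a w i = a := by
  simp [insertCoord]

@[simp] theorem insertCoord_succAbove (i : Fin 3) (a : ℂ) (w : C2) (j : Fin 2) :
    insertCoord i a w (i.succAbove j) = w j := by
  simp [insertCoord]

theorem insertCoord_one_ne_zero (i : Fin 3) (w : C2) : insertCoord i 1 w ≠ 0 := by
  intro h
  have := congrArg (fun Z : C3 => Z i) h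
  simp at this

theorem contDiff_insertCoord (i : Fin 3) (a : ℂ) : ContDiff ℂ ω (insertCoord i a) := by
  rw [contDiff_euclidean]
  intro k
  rcases Fin.eq_self_or_eq_succAbove i k with rfl | ⟨j, rfl⟩
  · simpa using contDiff_const
  · simp only [insertCoord_succAbove]
    fun_prop

/-- The inverse `w ↦ [w with 1 inserted in place i]` of the affine coordinates. -/
def ofAffine (i : Fin 3) (w : C2) : CP2 := mk ⟨insertCoord i 1 w, insertCoord_one_ne_zero i w⟩

theorem isOpen_affineDomain (i : Fin 3) : IsOpen (affineDomain i) := by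
  rw [← isQuotientMap_mk.isOpen_preimage]
  have : mk ⁻¹' affineDomain i = {Z : {Z : C3 // Z ≠ 0} | (Z : C3) i ≠ 0} := rfl
  rw [this]
  exact isOpen_ne_fun (by fun_prop) continuous_const

theorem continuousOn_affineCoord (i : Fin 3) : ContinuousOn (affineCoord i) (affineDomain i) := by
  rw [isQuotientMap_mk.continuousOn_isOpen_iff (isOpen_affineDomain i)]
  have h : ∀ Z ∈ mk ⁻¹' affineDomain i, (Z : C3) i ≠ 0 := fun Z hZ => hZ
  have : affineCoord i ∘ mk = fun Z : {Z : C3 // Z ≠ 0} =>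
      (WithLp.toLp 2 fun j => (Z : C3) (i.succAbove j) / (Z : C3) i : C2) := rfl
  rw [this]
  refine (PiLp.continuous_toLp 2 _).comp_continuousOn (continuousOn_pi.2 fun j => ?_)
  exact ContinuousOn.div (by fun_prop) (by fun_prop) h

theorem continuous_ofAffine (i : Fin 3) : Continuous (ofAffine i) :=
  isQuotientMap_mk.continuous.comp
    (Continuous.subtype_mk (contDiff_insertCoord i 1).continuous _)

/-- The affine chart of `ℂP²` on `{[Z] | Zᵢ ≠ 0}`. -/
def affineChart (i : Fin 3) : OpenPartialHomeomorph CP2 C2 where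
  toFun := affineCoord i
  invFun := ofAffine i
  source := affineDomain i
  target := Set.univ
  map_source' _ _ := Set.mem_univ _
  map_target' w _ := by simp [ofAffine]
  left_inv' q hq := by
    obtain ⟨Z, rfl⟩ := isQuotientMap_mk.surjective q
    have hZ : (Z : C3) i ≠ 0 := hq
    refine (mk_eq_mk _ _).2 ⟨((Z : C3) i)⁻¹, ?_⟩
    ext k
    rcases Fin.eq_self_or_eq_succAbove i k with rfl | ⟨j, rfl⟩
    · simp [hZ]
    · simp [div_eq_inv_mul]
  right_inv' w _ := by
    ext j
    simp [ofAffine]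
  open_source := isOpen_affineDomain i
  open_target := isOpen_univ
  continuousOn_toFun := continuousOn_affineCoord i
  continuousOn_invFun := (continuous_ofAffine i).continuousOn

theorem exists_mem_affineDomain (q : CP2) : ∃ i, q ∈ affineDomain i := by
  obtain ⟨Z, rfl⟩ := isQuotientMap_mk.surjective q
  by_contra! h
  refine Z.2 ?_
  ext i
  simpa using h i

/-- An index of a nonvanishing homogeneous coordinate of `q`. -/
def chartIndex (q : CP2) : Fin 3 := (exists_mem_affineDomain q).choose

theorem mem_affineDomain_chartIndex (q : CP2) : q ∈ affineDomain (chartIndex q) :=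
  (exists_mem_affineDomain q).choose_spec

/-- The atlas of the three affine charts. -/
instance : ChartedSpace C2 CP2 where
  atlas := Set.range affineChart
  chartAt q := affineChart (chartIndex q)
  mem_chart_source := mem_affineDomain_chartIndex
  chart_mem_atlas _ := Set.mem_range_self _

/-- `ℂP²` is a complex manifold. -/
instance : IsManifold 𝓘(ℂ, C2) ω CP2 := by
  refine isManifold_of_contDiffOn _ _ _ ?_
  rintro _ _ ⟨i, rfl⟩ ⟨j, rfl⟩
  simp only [modelWithCornersSelf_coe, modelWithCornersSelf_coe_symm, Function.id_comp,
    Function.comp_id, Set.range_id, Set.inter_univ, Set.preimage_id]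
  intro w hw
  have hw' : insertCoord i 1 w j ≠ 0 := hw.2
  refine ContDiffAt.contDiffWithinAt ?_
  rw [contDiffAt_euclidean]
  intro k
  have h := contDiff_euclidean.1 (contDiff_insertCoord i 1)
  exact (h (j.succAbove k)).contDiffAt.div (h j).contDiffAt hw'

/-- The Fubini–Study Hermitian form on the tangent space at `q` (conjugate linear in `v`), in
homogeneous coordinates
`(|Z|² ⟨dZ v, dZ w⟩ - ⟨dZ v, Z⟩ ⟨Z, dZ w⟩) / |Z|⁴`, where `Z` is the holomorphic section with `1` in
place `i` given by the preferred affine chart at `q`. Its real part is the Fubini–Study metric of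
constant holomorphic sectional curvature `4`. -/
def fubiniStudy (q : CP2) (v w : TangentSpace 𝓘(ℝ, C2) q) : ℂ :=
  let i := chartIndex q
  let Z : C3 := insertCoord i 1 (affineCoord i q)
  let V : C3 := insertCoord i 0 v
  let W : C3 := insertCoord i 0 w
  ((‖Z‖ : ℂ) ^ 2 * inner ℂ V W - inner ℂ V Z * inner ℂ Z W) / (‖Z‖ : ℂ) ^ 4

/-- The Fubini–Study metric. -/
def fsMetric (q : CP2) (v w : TangentSpace 𝓘(ℝ, C2) q) : ℝ := (fubiniStudy q v w).re

/-- The Kähler form `(v, w) ↦ g (i v, w)` of the Fubini–Study metric. -/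
def kaehlerForm (q : CP2) (v w : TangentSpace 𝓘(ℝ, C2) q) : ℝ :=
  let v' : C2 := v
  fsMetric q (Complex.I • v') w

end CP2

/-! ### The Hopf fibration -/

instance : Fact (Module.finrank ℝ C3 = 5 + 1) :=
  ⟨by rw [finrank_real_of_complex, finrank_euclideanSpace_fin]⟩

/-- The unit sphere `S⁵ ⊆ ℂ³`. -/
abbrev S5 : Type := Metric.sphere (0 : C3) 1

/-- The Hopf fibration `S⁵ → ℂP²`, `u ↦ [u]`. -/
def hopf (u : S5) : CP2 := CP2.mk ⟨u, ne_zero_of_mem_unit_sphere u⟩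

/-! ### Riemann surfaces, immersions and lifts -/

/-- A Riemann surface: a connected Hausdorff complex manifold of complex dimension one. -/
class RiemannSurface (M : Type*) [TopologicalSpace M] [ChartedSpace ℂ M] : Prop extends
  T2Space M, ConnectedSpace M, IsManifold 𝓘(ℂ) ω M

/-- A smooth immersion of a surface: a real `C^∞` map whose differential is injective at every
point. -/
def IsSmoothImmersion {M : Type*} [TopologicalSpace M] [ChartedSpace ℂ M]
    {F : Type*} [NormedAddCommGroup F] [NormedSpace ℝ F]
    {N : Type*} [TopologicalSpace N] [ChartedSpace F N] (f : M → N) : Prop :=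
  ContMDiff 𝓘(ℝ, ℂ) 𝓘(ℝ, F) ∞ f ∧
    ∀ p, Function.Injective (mfderiv 𝓘(ℝ, ℂ) 𝓘(ℝ, F) f p)

section

variable {M : Type*} [TopologicalSpace M] [ChartedSpace ℂ M]

/-- The Kähler angle `θ ∈ [0, π]` of an immersion `f : M → ℂP²` at `p`: with `X`, `Y` the images
under the differential of the positively oriented basis `1, i` of the tangent space of `M` at `p`,
`cos θ` is the Kähler form on `(X, Y)` divided by the area of the parallelogram spanned by them. -/
def kaehlerAngle (f : M → CP2) (p : M) : ℝ :=
  let X := mfderiv 𝓘(ℝ, ℂ) 𝓘(ℝ, C2) f p (1 : ℂ)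
  let Y := mfderiv 𝓘(ℝ, ℂ) 𝓘(ℝ, C2) f p Complex.I
  Real.arccos (CP2.kaehlerForm (f p) X Y /
    √(CP2.fsMetric (f p) X X * CP2.fsMetric (f p) Y Y - CP2.fsMetric (f p) X Y ^ 2))

/-- A complex point: a holomorphic (`θ = 0`) or anti-holomorphic (`θ = π`) point. -/
def IsComplexPoint (f : M → CP2) (p : M) : Prop :=
  kaehlerAngle f p = 0 ∨ kaehlerAngle f p = Real.pi

/-- A global lift of `f` to `S⁵`: an immersion `F : M → S⁵` with `f = hopf ∘ F`. -/
def IsGlobalLift (f : M → CP2) (F : M → S5) : Prop :=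
  IsSmoothImmersion (F := EuclideanSpace ℝ (Fin 5)) F ∧ hopf ∘ F = f

/-- A covering of Riemann surfaces with three sheets: a holomorphic covering map all of whose
fibres have exactly three points. -/
def IsThreeFoldCovering {M' : Type*} [TopologicalSpace M'] [ChartedSpace ℂ M']
    (τ : M' → M) : Prop :=
  IsCoveringMap τ ∧ MDifferentiable 𝓘(ℂ) 𝓘(ℂ) τ ∧ ∀ p, (τ ⁻¹' {p}).ncard = 3

end

end

noncomputable section

open Topology

/-! ### Complex manifolds as real manifolds -/

/-! Let `g` be a local lift of `f` to `ℂ³ ∖ 0` and consider `D = det(g, ∂g/∂x, ∂g/∂y)` in a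
holomorphic coordinate `x + iy`. It vanishes exactly where the image of `df` is a complex line, so
it has no zeros when there are no complex points (`jetDetIn_chartAt_ne_zero`). Replacing `g` by `h •
g` multiplies `D` by `h³` (`jetDet_smul`), and a holomorphic change of coordinate multiplies it by
`|ψ'|² > 0` (`jetDet_comp`).

Hence the argument of `D` depends only on the lift, and the condition "`D` is real and positive"
singles out, over each point, unit lifts that differ by cubic roots of unity. Locally they are given
by smooth sections (`exists_local_positiveLift`). The pairs (point, positive lift) therefore form a
three-sheeted covering of `M`, on which the second component is a tautological lift of `f ∘ τ`.

What remains is connectedness. A clopen set of positive lifts meets every fibre in the same number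
of points. If that number is 1 or 2, the set or its complement is a section, hence a global lift of
`f`; otherwise the set is empty or everything. So if `f` has no global lift, the covering is
connected and is the required Riemann surface. -/

theorem contDiffOn_chart_transition {𝕜 E M : Type*} [NontriviallyNormedField 𝕜]
    [NormedAddCommGroup E] [NormedSpace 𝕜 E] [TopologicalSpace M] [ChartedSpace E M] {n : ℕ∞ω}
    [IsManifold 𝓘(𝕜, E) n M] {e e' : OpenPartialHomeomorph M E} (he : e ∈ atlas E M)
    (he' : e' ∈ atlas E M) : ContDiffOn 𝕜 n (e.symm ≫ₕ e') (e.symm ≫ₕ e').source := by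
  have h := ((contDiffGroupoid n 𝓘(𝕜, E)).compatible he he').1
  simpa [contDiffPregroupoid] using h

theorem isManifold_real_of_complex {E M : Type*}
    [NormedAddCommGroup E] [NormedSpace ℂ E] [NormedSpace ℝ E] [IsScalarTower ℝ ℂ E]
    [TopologicalSpace M] [ChartedSpace E M] {n : ℕ∞ω}
    [IsManifold 𝓘(ℂ, E) n M] : IsManifold 𝓘(ℝ, E) n M := by
  refine isManifold_of_contDiffOn _ _ _ fun e e' he he' => ?_
  simpa using (contDiffOn_chart_transition (𝕜 := ℂ) (n := n) he he').restrict_scalars ℝ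

/-! ### Pulling back a manifold structure along a local homeomorphism -/

namespace IsLocalHomeomorph

variable {𝕜 E M M' : Type*} [NontriviallyNormedField 𝕜] [NormedAddCommGroup E] [NormedSpace 𝕜 E]
  [TopologicalSpace M] [ChartedSpace E M] [TopologicalSpace M'] {τ : M' → M}

/-- The charted space structure on the source of a local homeomorphism `τ` whose charts are local
inverses of `τ` followed by charts of the target. -/
abbrev pullbackChartedSpace (hτ : IsLocalHomeomorph τ) : ChartedSpace E M' where
  atlas := {c | ∃ e : OpenPartialHomeomorph M' M, τ = e ∧ ∃ x ∈ atlas E M, c = e ≫ₕ x}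
  chartAt p := (hτ p).choose ≫ₕ chartAt E (τ p)
  mem_chart_source p := by
    have h := (hτ p).choose_spec
    have h2 : (hτ p).choose p = τ p := (congrFun h.2 p).symm
    simp [h.1, h2]
  chart_mem_atlas p := ⟨_, (hτ p).choose_spec.2, _, chart_mem_atlas E _, rfl⟩

/-- Any two of the local homeomorphisms `e`, `e'` have the same underlying map `τ`, so they cancel
in a transition map and leave a transition map of `M`. The field is arbitrary because the same atlas
serves as a complex and as a real structure. -/
theorem isManifold_pullback (hτ : IsLocalHomeomorph τ) {n : ℕ∞ω} [IsManifold 𝓘(𝕜, E) n M] :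
    @IsManifold 𝕜 _ E _ _ E _ 𝓘(𝕜, E) n M' _ hτ.pullbackChartedSpace := by
  let _ : ChartedSpace E M' := hτ.pullbackChartedSpace
  refine isManifold_of_contDiffOn _ _ _ ?_
  rintro _ _ ⟨e, he, x, hx, rfl⟩ ⟨e', he', y, hy, rfl⟩
  have key : ∀ z ∈ ((e ≫ₕ x).symm ≫ₕ (e' ≫ₕ y)).source,
      e' (e.symm (x.symm z)) = x.symm z := by
    intro z hz
    simp only [OpenPartialHomeomorph.trans_source, OpenPartialHomeomorph.symm_source,
      OpenPartialHomeomorph.trans_target, Set.mem_inter_iff, Set.mem_preimage] at hz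
    rw [← he', he]
    exact e.right_inv hz.1.2
  simp only [modelWithCornersSelf_coe, modelWithCornersSelf_coe_symm, Function.id_comp,
    Function.comp_id, Set.range_id, Set.inter_univ, Set.preimage_id]
  refine ((contDiffOn_chart_transition (𝕜 := 𝕜) (n := n) hx hy).mono ?_).congr ?_
  · intro z hz
    have hk := key z hz
    simp only [OpenPartialHomeomorph.trans_source, OpenPartialHomeomorph.symm_source,
      OpenPartialHomeomorph.trans_target, Set.mem_inter_iff, Set.mem_preimage,
      OpenPartialHomeomorph.coe_trans_symm, Function.comp_apply] at hz ⊢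
    exact ⟨hz.1.1, by rw [← hk]; exact hz.2.2⟩
  · intro z hz
    simp [key z hz]

/-- The preferred chart at `p` is a restriction of `τ` followed by the preferred chart at `τ p`, so
`τ` reads as the identity. Smoothness, holomorphy and injectivity of the differential all follow
from this. -/
theorem writtenInExtChartAt_pullback (hτ : IsLocalHomeomorph τ) (p : M') :
    letI : ChartedSpace E M' := hτ.pullbackChartedSpace
    writtenInExtChartAt 𝓘(𝕜, E) 𝓘(𝕜, E) p τ =ᶠ[𝓝 (extChartAt 𝓘(𝕜, E) p p)] id := by
  let _ : ChartedSpace E M' := hτ.pullbackChartedSpace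
  filter_upwards [extChartAt_target_mem_nhds (I := 𝓘(𝕜, E)) p] with z hz
  have h := (hτ p).choose_spec
  simp only [extChartAt, OpenPartialHomeomorph.extend, modelWithCornersSelf_partialEquiv,
    PartialEquiv.trans_refl] at hz
  have hz' : z ∈ ((hτ p).choose ≫ₕ chartAt E (τ p)).target := hz
  simp only [OpenPartialHomeomorph.trans_target, Set.mem_inter_iff, Set.mem_preimage] at hz'
  have h1 : τ ((hτ p).choose.symm ((chartAt E (τ p)).symm z)) = (chartAt E (τ p)).symm z := by
    rw [congrFun h.2]
    exact (hτ p).choose.right_inv hz'.2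
  have h2 : writtenInExtChartAt 𝓘(𝕜, E) 𝓘(𝕜, E) p τ z =
    chartAt E (τ p) (τ ((hτ p).choose.symm ((chartAt E (τ p)).symm z))) := by
    simp [writtenInExtChartAt, chartAt]
    rfl
  rw [h2, h1]
  exact (chartAt E (τ p)).right_inv hz'.1

theorem contMDiff_pullback (hτ : IsLocalHomeomorph τ) {n : ℕ∞ω} :
    letI : ChartedSpace E M' := hτ.pullbackChartedSpace
    ContMDiff 𝓘(𝕜, E) 𝓘(𝕜, E) n τ := by
  let _ : ChartedSpace E M' := hτ.pullbackChartedSpace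
  intro p
  refine contMDiffAt_iff.2 ⟨hτ.continuous.continuousAt, ContDiffAt.contDiffWithinAt ?_⟩
  exact contDiffAt_id.congr_of_eventuallyEq (hτ.writtenInExtChartAt_pullback (𝕜 := 𝕜) p)

theorem mfderiv_pullback_injective (hτ : IsLocalHomeomorph τ) (p : M') :
    letI : ChartedSpace E M' := hτ.pullbackChartedSpace
    Function.Injective (mfderiv 𝓘(𝕜, E) 𝓘(𝕜, E) τ p) := by
  let _ : ChartedSpace E M' := hτ.pullbackChartedSpace
  have h : HasMFDerivAt 𝓘(𝕜, E) 𝓘(𝕜, E) τ p (ContinuousLinearMap.id 𝕜 E) :=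
    ⟨hτ.continuous.continuousAt, (HasFDerivAt.congr_of_eventuallyEq (hasFDerivAt_id _)
      (hτ.writtenInExtChartAt_pullback (𝕜 := 𝕜) p)).hasFDerivWithinAt⟩
  rw [h.mfderiv]
  exact fun a b hab => hab

end IsLocalHomeomorph

/-! ### The determinant of a lift and its first derivatives -/

/-- The determinant of three vectors of `ℂ³`. -/
def det3 (a b c : C3) : ℂ :=
  a 0 * (b 1 * c 2 - b 2 * c 1) - a 1 * (b 0 * c 2 - b 2 * c 0) + a 2 * (b 0 * c 1 - b 1 * c 0)

/-- The determinant of `g`, `∂g/∂x`, `∂g/∂y` for a map `g` of the variable `x + i y`. -/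
def jetDet (g : ℂ → C3) (z : ℂ) : ℂ := det3 (g z) (fderiv ℝ g z 1) (fderiv ℝ g z Complex.I)

theorem Filter.EventuallyEq.jetDet_eq {g g' : ℂ → C3} {z : ℂ} (h : g =ᶠ[𝓝 z] g') :
    jetDet g z = jetDet g' z := by
  simp only [jetDet, h.fderiv_eq, h.eq_of_nhds]

/-- By the product rule the derivatives of `h` contribute only multiples of `g z`, which the first
argument of the determinant kills; each of the three arguments then scales by `h z`. -/
theorem jetDet_smul {h : ℂ → ℂ} {g : ℂ → C3} {z : ℂ} (hh : DifferentiableAt ℝ h z)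
    (hg : DifferentiableAt ℝ g z) : jetDet (fun w => h w • g w) z = h z ^ 3 * jetDet g z := by
  have := (hh.hasFDerivAt.smul hg.hasFDerivAt).fderiv
  simp only [jetDet, det3]
  erw [this]
  simp
  ring

/-- The last two arguments are transformed by the real matrix of multiplication by `a`, whose
determinant is `|a|²`. Holomorphy of the coordinate change is what makes this factor positive. -/
theorem jetDet_comp {g : ℂ → C3} {ψ : ℂ → ℂ} {z a : ℂ} (hg : DifferentiableAt ℝ g (ψ z))
    (hψ : HasDerivAt ψ a z) : jetDet (g ∘ ψ) z = Complex.normSq a * jetDet g (ψ z) := by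
  have hψ' := hψ.hasFDerivAt.restrictScalars ℝ
  have h1 := (hg.hasFDerivAt.comp z hψ').fderiv
  have e1 : fderiv ℝ (g ∘ ψ) z 1 =
      a.re • fderiv ℝ g (ψ z) 1 + a.im • fderiv ℝ g (ψ z) Complex.I := by
    rw [h1, ← map_smul, ← map_smul, ← map_add]
    simp
  have e2 : fderiv ℝ (g ∘ ψ) z Complex.I =
      -a.im • fderiv ℝ g (ψ z) 1 + a.re • fderiv ℝ g (ψ z) Complex.I := by
    rw [h1, ← map_smul, ← map_smul, ← map_add]
    refine congrArg (fderiv ℝ g (ψ z)) (Complex.ext ?_ ?_) <;> simp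
  simp only [jetDet, e1, e2, det3, Function.comp_apply, Complex.normSq_apply]
  simp
  ring

theorem ContDiffOn.jetDet {g : ℂ → C3} {s : Set ℂ} (hg : ContDiffOn ℝ ∞ g s) (hs : IsOpen s) :
    ContDiffOn ℝ ∞ (jetDet g) s := by
  have h := hg.fderiv_of_isOpen hs (m := ∞) (by simp)
  have coord {φ : ℂ → C3} (hφ : ContDiffOn ℝ ∞ φ s) (i : Fin 3) :
      ContDiffOn ℝ ∞ (fun z => φ z i) s :=
    ((EuclideanSpace.proj i : C3 →L[ℂ] ℂ).restrictScalars
      ℝ).contDiff.comp_contDiffOn hφ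
  have h0 := coord hg
  have h1 := coord (h.clm_apply (contDiffOn_const (c := (1 : ℂ))))
  have h2 := coord (h.clm_apply (contDiffOn_const (c := Complex.I)))
  unfold _root_.jetDet det3
  fun_prop

/-! ### Affine lifts -/

namespace CP2

/-- The section `[Z] ↦ Z / Zᵢ` over the affine domain. -/
def affineLift (i : Fin 3) (q : CP2) : C3 := insertCoord i 1 (affineCoord i q)

theorem affineLift_mk {i : Fin 3} {Z : {Z : C3 // Z ≠ 0}} (h : (Z : C3) i ≠ 0) :
    affineLift i (mk Z) = ((Z : C3) i)⁻¹ • (Z : C3) := by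
  ext k
  rcases Fin.eq_self_or_eq_succAbove i k with rfl | ⟨j, rfl⟩
  · simp [affineLift, h]
  · simp [affineLift, div_eq_inv_mul]

theorem affineLift_ne_zero (i : Fin 3) (q : CP2) : affineLift i q ≠ 0 :=
  insertCoord_one_ne_zero i _

theorem mk_affineLift {i : Fin 3} {q : CP2} (hq : q ∈ affineDomain i) :
    mk ⟨affineLift i q, affineLift_ne_zero i q⟩ = q :=
  (affineChart i).left_inv hq

theorem affineLift_apply_ne_zero {i j : Fin 3} {q : CP2} (hi : q ∈ affineDomain i)
    (hj : q ∈ affineDomain j) : affineLift j q i ≠ 0 := by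
  rw [← mk_affineLift hj] at hi
  exact hi

theorem affineLift_eq_smul {i j : Fin 3} {q : CP2} (hi : q ∈ affineDomain i)
    (hj : q ∈ affineDomain j) : affineLift i q = (affineLift j q i)⁻¹ • affineLift j q := by
  conv_lhs => rw [← mk_affineLift hj]
  exact affineLift_mk (affineLift_apply_ne_zero hi hj)

instance : IsManifold 𝓘(ℝ, C2) ∞ CP2 :=
  have : IsManifold 𝓘(ℝ, C2) ω CP2 := isManifold_real_of_complex
  .of_le (n := ω) le_top

theorem contMDiffOn_affineCoord (i : Fin 3) :
    ContMDiffOn 𝓘(ℝ, C2) 𝓘(ℝ, C2) ∞ (affineCoord i) (affineDomain i) :=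
  contMDiffOn_of_mem_maximalAtlas
    (IsManifold.subset_maximalAtlas (Set.mem_range_self i) : affineChart i ∈ _)

theorem contMDiffOn_affineLift (i : Fin 3) :
    ContMDiffOn 𝓘(ℝ, C2) 𝓘(ℝ, C3) ∞ (affineLift i) (affineDomain i) :=
  (((contDiff_insertCoord i 1).of_le le_top).restrict_scalars ℝ).contMDiff.comp_contMDiffOn
    (contMDiffOn_affineCoord i)

end CP2

/-! ### The Kähler angle and the determinant -/

namespace CP2

theorem fubiniStudy_smul_smul (q : CP2) (v : C2) (a b : ℂ) :
    fubiniStudy q (a • v) (b • v) = starRingEnd ℂ a * b * fubiniStudy q v v := by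
  have h (c : ℂ) : insertCoord (chartIndex q) 0 (c • v) = c • insertCoord (chartIndex q) 0 v := by
    ext k
    rcases Fin.eq_self_or_eq_succAbove (chartIndex q) k with hk | ⟨j, hk⟩
    · rw [hk]; simp
    · rw [hk]; simp
  simp only [fubiniStudy]
  erw [h a, h b]
  simp only [inner_smul_left, inner_smul_right]
  ring

/-- Cauchy–Schwarz is strict here: `Z` has entry `1` in place `i` and `V` has entry `0` there, so
the two nonzero vectors are not parallel. -/
theorem exists_fubiniStudy_self (q : CP2) {v : C2} (hv : v ≠ 0) :
    ∃ a : ℝ, 0 < a ∧ fubiniStudy q v v = a := by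
  set i := chartIndex q with hi
  set Z : C3 := insertCoord i 1 (affineCoord i q) with hZ
  set V : C3 := insertCoord i 0 v with hV
  have hZ0 : Z ≠ 0 := insertCoord_one_ne_zero i _
  have hV0 : V ≠ 0 := by
    intro h
    refine hv ?_
    ext j
    have := congrArg (fun W : C3 => W (i.succAbove j)) h
    simpa [hV] using this
  have hlt : ‖inner ℂ Z V‖ < ‖Z‖ * ‖V‖ := by
    refine lt_of_le_of_ne (norm_inner_le_norm _ _) fun h => ?_
    have h' := (norm_inner_eq_norm_iff hZ0 hV0).1 h
    obtain ⟨r, hr, h'⟩ := h'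
    have := congrArg (fun W : C3 => W i) h'
    simp [hV, hZ] at this
    exact hr this.symm
  refine ⟨(‖Z‖ ^ 2 * ‖V‖ ^ 2 - ‖inner ℂ Z V‖ ^ 2) / ‖Z‖ ^ 4, ?_, ?_⟩
  · have h0 : 0 < ‖Z‖ := norm_pos_iff.2 hZ0
    have : ‖inner ℂ Z V‖ ^ 2 < (‖Z‖ * ‖V‖) ^ 2 := by gcongr
    rw [mul_pow] at this
    exact div_pos (sub_pos.2 this) (by positivity)
  · have h1 : fubiniStudy q v v =
      ((‖Z‖ : ℂ) ^ 2 * inner ℂ V V - inner ℂ V Z * inner ℂ Z V) / (‖Z‖ : ℂ) ^ 4 := rfl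
    rw [h1, inner_self_eq_norm_sq_to_K, ← inner_conj_symm V Z, ← Complex.normSq_eq_conj_mul_self,
      Complex.normSq_eq_norm_sq]
    push_cast
    rfl

end CP2

section

variable {M : Type*} [TopologicalSpace M] [ChartedSpace ℂ M]

/-- If the real derivative spans a complex line then the point is a complex point. -/
theorem isComplexPoint_of_mfderiv_eq_smul {f : M → CP2} {p : M}
    (hf : Function.Injective (mfderiv 𝓘(ℝ, ℂ) 𝓘(ℝ, C2) f p)) (X : C2) (z : ℂ)
    (hX : mfderiv 𝓘(ℝ, ℂ) 𝓘(ℝ, C2) f p (1 : ℂ) = X)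
    (hz : mfderiv 𝓘(ℝ, ℂ) 𝓘(ℝ, C2) f p Complex.I = z • X) : IsComplexPoint f p := by
  have hX0 : X ≠ 0 := by
    intro h
    rw [h] at hX
    have : (1 : ℂ) = 0 := hf (hX.trans (map_zero _).symm)
    exact one_ne_zero this
  -- A real `z` would make the images of `1` and `i` linearly dependent over `ℝ`, against
  -- injectivity.
  have him : z.im ≠ 0 := by
    intro h
    have h1 : z • X = z.re • X := by
      conv_lhs => rw [← Complex.re_add_im z, h]
      simp
    rw [h1, ← hX] at hz
    have h2 : Complex.I = z.re • (1 : ℂ) := hf (hz.trans (map_smul _ _ _).symm)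
    simpa using congrArg Complex.im h2
  obtain ⟨a, ha, hXX⟩ := CP2.exists_fubiniStudy_self (f p) hX0
  have e (b c : ℂ) : CP2.fubiniStudy (f p) (b • X) (c • X) = starRingEnd ℂ b * c * a := by
    rw [CP2.fubiniStudy_smul_smul, hXX]
  have e1 : CP2.fsMetric (f p) X X = a := by simp [CP2.fsMetric, hXX]
  have e2 : CP2.fsMetric (f p) X (z • X) = z.re * a := by
    have := e 1 z
    rw [one_smul] at this
    change (CP2.fubiniStudy (f p) X (z • X)).re = _
    rw [this]
    simp
  have e3 : CP2.fsMetric (f p) (z • X) (z • X) = (z.re ^ 2 + z.im ^ 2) * a := by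
    change (CP2.fubiniStudy (f p) (z • X) (z • X)).re = _
    rw [e, ← Complex.normSq_eq_conj_mul_self, ← Complex.ofReal_mul, Complex.ofReal_re,
      Complex.normSq_apply]
    ring
  have e4 : CP2.kaehlerForm (f p) X (z • X) = z.im * a := by
    simp [CP2.kaehlerForm, CP2.fsMetric, e]
  -- With Kähler form `z.im * a` and this area, `cos θ` is the sign of `z.im`, hence `±1`.
  have harea : √(a * ((z.re ^ 2 + z.im ^ 2) * a) - (z.re * a) ^ 2) = |z.im| * a := by
    rw [show a * ((z.re ^ 2 + z.im ^ 2) * a) - (z.re * a) ^ 2 = (z.im * a) ^ 2 by ring,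
      Real.sqrt_sq_eq_abs, abs_mul, abs_of_pos ha]
  have hang : kaehlerAngle f p = Real.arccos (z.im / |z.im|) := by
    have h : kaehlerAngle f p = Real.arccos (CP2.kaehlerForm (f p) X (z • X) /
      √(CP2.fsMetric (f p) X X * CP2.fsMetric (f p) (z • X) (z • X) -
        CP2.fsMetric (f p) X (z • X) ^ 2)) := by
      rw [← hz, ← hX]; rfl
    rw [h, e1, e2, e3, e4, harea, mul_div_mul_right _ _ ha.ne']
  rcases him.lt_or_gt with h | h
  · right
    rw [hang, abs_of_neg h, div_neg, div_self him, Real.arccos_neg_one]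
  · left
    rw [hang, abs_of_pos h, div_self him, Real.arccos_one]

theorem exists_smul_eq_of_det_eq_zero {X Y : C2} (hX : X ≠ 0) (h : X 0 * Y 1 - X 1 * Y 0 = 0) :
    ∃ z : ℂ, Y = z • X := by
  by_cases h0 : X 0 = 0
  · have h1 : X 1 ≠ 0 := by
      intro h1
      refine hX ?_
      ext j
      fin_cases j <;> simp [h0, h1]
    have hY : Y 0 = 0 := by simpa [h0, h1] using h
    refine ⟨Y 1 / X 1, ?_⟩
    ext j
    fin_cases j
    · simp [h0, hY]
    · simp [h1]
  · refine ⟨Y 0 / X 0, ?_⟩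
    ext j
    fin_cases j
    · simp [h0]
    · simp
      field_simp
      linear_combination h

/-- Expanding along coordinate `i`, where the entries are `1, 0, 0`, leaves the `2 × 2` minor up to
sign; the sign is negative only for `i = 1`. -/
theorem det3_insertCoord (i : Fin 3) (w X Y : C2) :
    det3 (CP2.insertCoord i 1 w) (CP2.insertCoord i 0 X) (CP2.insertCoord i 0 Y) = 0 ↔
      X 0 * Y 1 - X 1 * Y 0 = 0 := by
  have h01 (a : ℂ) (v : C2) : CP2.insertCoord 0 a v 1 = v 0 := CP2.insertCoord_succAbove 0 a v 0
  have h02 (a : ℂ) (v : C2) : CP2.insertCoord 0 a v 2 = v 1 := CP2.insertCoord_succAbove 0 a v 1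
  have h10 (a : ℂ) (v : C2) : CP2.insertCoord 1 a v 0 = v 0 := CP2.insertCoord_succAbove 1 a v 0
  have h11 (a : ℂ) (v : C2) : CP2.insertCoord 1 a v 1 = a := CP2.insertCoord_same 1 a v
  have h12 (a : ℂ) (v : C2) : CP2.insertCoord 1 a v 2 = v 1 := CP2.insertCoord_succAbove 1 a v 1
  have h20 (a : ℂ) (v : C2) : CP2.insertCoord 2 a v 0 = v 0 := CP2.insertCoord_succAbove 2 a v 0
  have h21 (a : ℂ) (v : C2) : CP2.insertCoord 2 a v 1 = v 1 := CP2.insertCoord_succAbove 2 a v 1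
  have hi : i = 0 ∨ i = 1 ∨ i = 2 := by fin_cases i <;> simp
  rcases hi with rfl | rfl | rfl
  · simp [det3, h01, h02]
  · simp only [det3, h10, h11, h12]
    constructor <;> intro h <;> linear_combination -h
  · simp [det3, h20, h21]

/-- The map is affine, with linear part `insertCoord i 0`. -/
theorem hasFDerivAt_insertCoord (i : Fin 3) (a : ℂ) (w : C2) :
    ∃ L : C2 →L[ℝ] C3, (∀ v, L v = CP2.insertCoord i 0 v) ∧
      HasFDerivAt (CP2.insertCoord i a) L w := by
  let L : C2 →ₗ[ℝ] C3 :=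
    { toFun := CP2.insertCoord i 0
      map_add' := fun v v' => by
        ext k
        rcases Fin.eq_self_or_eq_succAbove i k with rfl | ⟨j, rfl⟩ <;> simp
      map_smul' := fun c v => by
        ext k
        rcases Fin.eq_self_or_eq_succAbove i k with rfl | ⟨j, rfl⟩ <;> simp }
  refine ⟨L.toContinuousLinearMap, fun v => rfl, ?_⟩
  have h : CP2.insertCoord i a = fun v => CP2.insertCoord i a 0 + L.toContinuousLinearMap v := by
    funext v
    change _ = CP2.insertCoord i a 0 + CP2.insertCoord i 0 v
    ext k
    rcases Fin.eq_self_or_eq_succAbove i k with rfl | ⟨j, rfl⟩ <;> simp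
  rw [h]
  exact L.toContinuousLinearMap.hasFDerivAt.const_add _

/-- The determinant of a lift and its first derivatives in a chart. -/
def jetDetIn (x : OpenPartialHomeomorph M ℂ) (G : M → C3) (p : M) : ℂ := jetDet (G ∘ x.symm) (x p)

-- In the preferred charts the lift is `insertCoord i 1 ∘ g`, so the determinant is `±(X₀Y₁ - X₁Y₀)`
-- for the partial derivatives `X`, `Y` of `g`. If it vanished, `Y` would be a complex multiple of
-- `X`, and `p` a complex point.
open CP2 in
theorem jetDetIn_chartAt_ne_zero {f : M → CP2} (hf : IsSmoothImmersion (F := C2) f) {p : M}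
    (hc : ¬ IsComplexPoint f p) :
    jetDetIn (chartAt ℂ p) (affineLift (chartIndex (f p)) ∘ f) p ≠ 0 := by
  set i := chartIndex (f p) with hi
  set g : ℂ → C2 := affineCoord i ∘ f ∘ (chartAt ℂ p).symm with hg
  have hm : MDifferentiableAt 𝓘(ℝ, ℂ) 𝓘(ℝ, C2) f p := (hf.1 p).mdifferentiableAt (by simp)
  have hd : HasFDerivAt g (fderiv ℝ g (chartAt ℂ p p)) (chartAt ℂ p p) := by
    have h1 := hm.differentiableWithinAt_writtenInExtChartAt
    have h2 : writtenInExtChartAt 𝓘(ℝ, ℂ) 𝓘(ℝ, C2) p f = g := rfl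
    rw [h2] at h1
    simp only [modelWithCornersSelf_coe, Set.range_id, differentiableWithinAt_univ] at h1
    exact h1.hasFDerivAt
  have hmf : mfderiv 𝓘(ℝ, ℂ) 𝓘(ℝ, C2) f p = fderiv ℝ g (chartAt ℂ p p) :=
    HasMFDerivAt.mfderiv ⟨hm.continuousAt, hd.hasFDerivWithinAt⟩
  have hinj := hf.2 p
  set X : C2 := fderiv ℝ g (chartAt ℂ p p) 1 with hX
  set Y : C2 := fderiv ℝ g (chartAt ℂ p p) Complex.I with hY
  have hX' : mfderiv 𝓘(ℝ, ℂ) 𝓘(ℝ, C2) f p (1 : ℂ) = X := by rw [hmf]; rfl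
  have hY' : mfderiv 𝓘(ℝ, ℂ) 𝓘(ℝ, C2) f p Complex.I = Y := by rw [hmf]; rfl
  have hX0 : X ≠ 0 := by
    intro h
    rw [h] at hX'
    have : (1 : ℂ) = 0 := hinj (hX'.trans (map_zero _).symm)
    exact one_ne_zero this
  obtain ⟨L, hL, hLd⟩ := hasFDerivAt_insertCoord i 1 (g (chartAt ℂ p p))
  have hG : (affineLift i ∘ f) ∘ (chartAt ℂ p).symm = insertCoord i 1 ∘ g := rfl
  rw [jetDetIn, hG, jetDet, (hLd.comp _ hd).fderiv]
  simp only [ContinuousLinearMap.comp_apply, hL, Function.comp_apply]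
  rw [Ne, det3_insertCoord]
  intro h
  obtain ⟨z, hz⟩ := exists_smul_eq_of_det_eq_zero hX0 h
  exact hc (isComplexPoint_of_mfderiv_eq_smul hinj X z hX' (hY'.trans hz))

end

/-! ### The chart determinant: smoothness and change of coordinates -/

open CP2

theorem isOpen_chart_target_inter {M : Type*} [TopologicalSpace M]
    (x : OpenPartialHomeomorph M ℂ) {s : Set M} (hs : IsOpen s) :
    IsOpen (x.target ∩ x.symm ⁻¹' s) :=
  x.isOpen_inter_preimage_symm hs

theorem mem_chart_target_inter {M : Type*} [TopologicalSpace M]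
    {x : OpenPartialHomeomorph M ℂ} {s : Set M} {p : M}
    (hx : p ∈ x.source) (hp : p ∈ s) : x p ∈ x.target ∩ x.symm ⁻¹' s :=
  ⟨x.map_source hx, by simpa [x.left_inv hx] using hp⟩

section

variable {M : Type*} [TopologicalSpace M] [ChartedSpace ℂ M]

theorem contDiffOn_comp_chart_symm [IsManifold 𝓘(ℝ, ℂ) ∞ M] {F : Type*} [NormedAddCommGroup F]
    [NormedSpace ℝ F] {x : OpenPartialHomeomorph M ℂ} (hx : x ∈ atlas ℂ M) {G : M → F} {s : Set M}
    (hG : ContMDiffOn 𝓘(ℝ, ℂ) 𝓘(ℝ, F) ∞ G s) :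
    ContDiffOn ℝ ∞ (G ∘ x.symm) (x.target ∩ x.symm ⁻¹' s) := by
  rw [← contMDiffOn_iff_contDiffOn]
  exact hG.comp ((contMDiffOn_symm_of_mem_maximalAtlas (IsManifold.subset_maximalAtlas hx)).mono
    Set.inter_subset_left) fun z hz => hz.2

theorem differentiableAt_comp_chart_symm [IsManifold 𝓘(ℝ, ℂ) ∞ M] {F : Type*}
    [NormedAddCommGroup F]
    [NormedSpace ℝ F] {x : OpenPartialHomeomorph M ℂ} (hx : x ∈ atlas ℂ M) {G : M → F} {s : Set M}
    (hG : ContMDiffOn 𝓘(ℝ, ℂ) 𝓘(ℝ, F) ∞ G s) (hs : IsOpen s) {p : M} (hpx : p ∈ x.source)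
    (hp : p ∈ s) : DifferentiableAt ℝ (G ∘ x.symm) (x p) :=
  ((contDiffOn_comp_chart_symm hx hG).contDiffAt ((isOpen_chart_target_inter x hs).mem_nhds
    (mem_chart_target_inter hpx hp))).differentiableAt (by simp)

theorem contMDiffOn_jetDetIn [IsManifold 𝓘(ℝ, ℂ) ∞ M] {x : OpenPartialHomeomorph M ℂ}
    (hx : x ∈ atlas ℂ M) {G : M → C3} {s : Set M}
    (hG : ContMDiffOn 𝓘(ℝ, ℂ) 𝓘(ℝ, C3) ∞ G s) (hs : IsOpen s) :
    ContMDiffOn 𝓘(ℝ, ℂ) 𝓘(ℝ, ℂ) ∞ (jetDetIn x G) (x.source ∩ s) := by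
  have h := (contDiffOn_comp_chart_symm hx hG).jetDet (isOpen_chart_target_inter x hs)
  exact h.contMDiffOn.comp ((contMDiffOn_of_mem_maximalAtlas
    (IsManifold.subset_maximalAtlas hx)).mono Set.inter_subset_left)
    fun p hp => mem_chart_target_inter hp.1 hp.2

/-- Change of coordinates multiplies the determinant by a positive number. -/
theorem jetDetIn_change_chart [IsManifold 𝓘(ℂ) ω M] {x y : OpenPartialHomeomorph M ℂ}
    (hx : x ∈ atlas ℂ M) (hy : y ∈ atlas ℂ M) {G : M → C3} {p : M} (hpx : p ∈ x.source)
    (hpy : p ∈ y.source) (hG : DifferentiableAt ℝ (G ∘ x.symm) (x p)) :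
    ∃ r : ℝ, 0 < r ∧ jetDetIn y G p = r * jetDetIn x G p := by
  have hd {x y : OpenPartialHomeomorph M ℂ} (hx : x ∈ atlas ℂ M) (hy : y ∈ atlas ℂ M)
      (hpx : p ∈ x.source) (hpy : p ∈ y.source) :
      DifferentiableAt ℂ (x.symm ≫ₕ y) (x p) := by
    refine (((contDiffOn_chart_transition (𝕜 := ℂ) (n := ω) hx hy)).contDiffAt
      ((x.symm ≫ₕ y).open_source.mem_nhds ?_)).differentiableAt (by simp)
    simp [hpx, hpy]
  have h1 := (hd hy hx hpy hpx).hasDerivAt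
  have h2 := (hd hx hy hpx hpy).hasDerivAt
  set a := deriv (y.symm ≫ₕ x) (y p)
  set b := deriv (x.symm ≫ₕ y) (x p)
  have hxp : (y.symm ≫ₕ x) (y p) = x p := by simp [hpy]
  have hyp : (x.symm ≫ₕ y) (x p) = y p := by simp [hpx]
  have hnear : (y.symm ≫ₕ x).source ∈ 𝓝 (y p) :=
    (y.symm ≫ₕ x).open_source.mem_nhds (by simp [hpx, hpy])
  -- The two transition maps are mutually inverse, so the chain rule gives `b * a = 1`.
  have ha : a ≠ 0 := by
    intro ha
    rw [← hxp] at h2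
    have h3 := h2.comp (y p) h1
    have h4 : (x.symm ≫ₕ y) ∘ (y.symm ≫ₕ x) =ᶠ[𝓝 (y p)] id := by
      filter_upwards [hnear] with z hz
      simp only [OpenPartialHomeomorph.trans_source, OpenPartialHomeomorph.symm_source,
        Set.mem_inter_iff, Set.mem_preimage] at hz
      simp [hz.1, hz.2]
    have h5 := h3.unique ((hasDerivAt_id (y p)).congr_of_eventuallyEq h4)
    simp [ha] at h5
  refine ⟨Complex.normSq a, Complex.normSq_pos.2 ha, ?_⟩
  have h6 : G ∘ y.symm =ᶠ[𝓝 (y p)] (G ∘ x.symm) ∘ (y.symm ≫ₕ x) := by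
    filter_upwards [hnear] with z hz
    simp only [OpenPartialHomeomorph.trans_source, OpenPartialHomeomorph.symm_source,
      Set.mem_inter_iff, Set.mem_preimage] at hz
    simp [hz.2]
  rw [jetDetIn, h6.jetDet_eq, jetDet_comp (by rwa [hxp]) h1, hxp]
  rfl

/-! ### Positive lifts -/

theorem contMDiffOn_affineLift_comp {f : M → CP2} (hf : ContMDiff 𝓘(ℝ, ℂ) 𝓘(ℝ, C2) ∞ f) (i : Fin 3) :
    ContMDiffOn 𝓘(ℝ, ℂ) 𝓘(ℝ, C3) ∞ (affineLift i ∘ f) (f ⁻¹' affineDomain i) :=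
  (contMDiffOn_affineLift i).comp hf.contMDiffOn fun _ h => h

theorem isOpen_preimage_affineDomain {f : M → CP2} (hf : ContMDiff 𝓘(ℝ, ℂ) 𝓘(ℝ, C2) ∞ f) (i : Fin 3) :
    IsOpen (f ⁻¹' affineDomain i) :=
  (isOpen_affineDomain i).preimage hf.continuous

/-- A complex number that is real and positive. -/
def IsPosReal (z : ℂ) : Prop := ∃ r : ℝ, 0 < r ∧ z = r

theorem isPosReal_real_mul {r : ℝ} (hr : 0 < r) {z : ℂ} : IsPosReal (r * z) ↔ IsPosReal z := by
  constructor
  · rintro ⟨t, ht, h⟩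
    refine ⟨t / r, by positivity, ?_⟩
    have : (r : ℂ) ≠ 0 := by exact_mod_cast hr.ne'
    push_cast
    rw [← h]
    field_simp
  · rintro ⟨t, ht, rfl⟩
    exact ⟨r * t, by positivity, by push_cast; rfl⟩

/-- Unit vectors `u` over `f p` for which the determinant of `u` and lifts of `∂f/∂x`, `∂f/∂y` is
real and positive. -/
def IsPositiveLift (f : M → CP2) (p : M) (u : C3) : Prop :=
  ‖u‖ = 1 ∧ ∃ c : ℂ, u = c • affineLift (chartIndex (f p)) (f p) ∧
    IsPosReal (c ^ 3 * jetDetIn (chartAt ℂ p) (affineLift (chartIndex (f p)) ∘ f) p)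

instance RiemannSurface.isManifold_real [RiemannSurface M] : IsManifold 𝓘(ℝ, ℂ) ∞ M :=
  have : IsManifold 𝓘(ℝ, ℂ) ω M := isManifold_real_of_complex
  .of_le (n := ω) le_top

variable [RiemannSurface M] {f : M → CP2}

/-- Both transformation rules at once: the change of chart on `M` gives the positive factor `r`, the
change of affine section gives the cube of the scaling function. -/
theorem jetDetIn_change (hf : ContMDiff 𝓘(ℝ, ℂ) 𝓘(ℝ, C2) ∞ f)
    {x y : OpenPartialHomeomorph M ℂ} (hx : x ∈ atlas ℂ M) (hy : y ∈ atlas ℂ M) {p : M}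
    (hpx : p ∈ x.source) (hpy : p ∈ y.source) {i j : Fin 3} (hi : f p ∈ affineDomain i)
    (hj : f p ∈ affineDomain j) :
    ∃ r : ℝ, 0 < r ∧ jetDetIn y (affineLift i ∘ f) p =
      r * ((affineLift j (f p) i)⁻¹ ^ 3 * jetDetIn x (affineLift j ∘ f) p) := by
  have hoi := isOpen_preimage_affineDomain hf i
  have hoj := isOpen_preimage_affineDomain hf j
  have hdi := differentiableAt_comp_chart_symm hx (contMDiffOn_affineLift_comp hf i) hoi hpx hi
  have hdj := differentiableAt_comp_chart_symm hx (contMDiffOn_affineLift_comp hf j) hoj hpx hj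
  obtain ⟨r, hr, h⟩ := jetDetIn_change_chart hx hy hpx hpy hdi
  refine ⟨r, hr, ?_⟩
  rw [h]
  congr 1
  have hne := affineLift_apply_ne_zero hi hj
  have e : (affineLift i ∘ f) ∘ x.symm =ᶠ[𝓝 (x p)] fun z =>
      (((affineLift j ∘ f) ∘ x.symm) z i)⁻¹ • ((affineLift j ∘ f) ∘ x.symm) z := by
    filter_upwards [(isOpen_chart_target_inter x (hoi.inter hoj)).mem_nhds
      (mem_chart_target_inter hpx ⟨hi, hj⟩)] with z hz
    exact affineLift_eq_smul hz.2.1 hz.2.2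
  have hdc : DifferentiableAt ℝ (fun z => ((affineLift j ∘ f) ∘ x.symm) z i) (x p) :=
    ((EuclideanSpace.proj i : C3 →L[ℂ] ℂ).restrictScalars ℝ).differentiableAt.comp _ hdj
  have hval : ((affineLift j ∘ f) ∘ x.symm) (x p) = affineLift j (f p) := by simp [hpx]
  refine (e.jetDet_eq.trans (jetDet_smul (hdc.inv (by rwa [hval])) hdj)).trans ?_
  simp only [hval]
  rfl

theorem jetDetIn_ne_zero (hf : IsSmoothImmersion (F := C2) f) {p : M}
    (hc : ¬ IsComplexPoint f p) {x : OpenPartialHomeomorph M ℂ} (hx : x ∈ atlas ℂ M)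
    (hpx : p ∈ x.source) {j : Fin 3} (hj : f p ∈ affineDomain j) :
    jetDetIn x (affineLift j ∘ f) p ≠ 0 := by
  obtain ⟨r, hr, h⟩ := jetDetIn_change hf.1 hx (chart_mem_atlas ℂ p) hpx (mem_chart_source ℂ p)
    (mem_affineDomain_chartIndex (f p)) hj
  intro h0
  refine jetDetIn_chartAt_ne_zero hf hc ?_
  rw [h, h0]
  simp

/-- The preferred chart and affine index may jump with `p`. This independence of the choices allows
one fixed chart and index to be used on a whole neighbourhood. A change of affine section is
absorbed into `c`, whose cube compensates the cubed factor of the determinant. -/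
theorem isPositiveLift_iff (hf : ContMDiff 𝓘(ℝ, ℂ) 𝓘(ℝ, C2) ∞ f)
    {x : OpenPartialHomeomorph M ℂ} (hx : x ∈ atlas ℂ M) {p : M}
    (hpx : p ∈ x.source) {j : Fin 3} (hj : f p ∈ affineDomain j) {u : C3} :
    IsPositiveLift f p u ↔ ‖u‖ = 1 ∧ ∃ c : ℂ, u = c • affineLift j (f p) ∧
      IsPosReal (c ^ 3 * jetDetIn x (affineLift j ∘ f) p) := by
  have hi := mem_affineDomain_chartIndex (f p)
  obtain ⟨r, hr, h⟩ := jetDetIn_change hf hx (chart_mem_atlas ℂ p) hpx (mem_chart_source ℂ p) hi hj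
  have hne := affineLift_apply_ne_zero hi hj
  set k := affineLift j (f p) (chartIndex (f p))
  refine and_congr_right fun _ => ?_
  rw [h, affineLift_eq_smul hi hj]
  constructor
  · rintro ⟨c, hu, hc⟩
    refine ⟨c * k⁻¹, by rw [hu, smul_smul], ?_⟩
    rw [← isPosReal_real_mul hr]
    convert hc using 1
    ring
  · rintro ⟨c, hu, hc⟩
    refine ⟨c * k, by rw [hu, smul_smul, mul_assoc, mul_inv_cancel₀ hne, mul_one], ?_⟩
    rw [← isPosReal_real_mul hr] at hc
    convert hc using 1
    field_simp

end

/-! ### Normalization by cube roots and local positive lifts -/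

theorem IsPosReal.eq_one_of_norm {z : ℂ} (h : IsPosReal z) (hz : ‖z‖ = 1) : z = 1 := by
  obtain ⟨r, hr, rfl⟩ := h
  rw [Complex.norm_real, Real.norm_of_nonneg hr.le] at hz
  simp [hz]

/-- A local branch of `w ^ (-1/3)`. Taking the logarithm of `w₀ / w`, which is `1` at `w₀`, keeps
away from the branch cut, and the constant `c₀` with `c₀ ^ 3 = w₀⁻¹` corrects the value. -/
theorem exists_contDiffOn_cubeRoot {w₀ : ℂ} (h₀ : w₀ ≠ 0) :
    ∃ S : Set ℂ, IsOpen S ∧ w₀ ∈ S ∧ ∃ k : ℂ → ℂ, ContDiffOn ℝ ∞ k S ∧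
      ∀ w ∈ S, k w ^ 3 * w = 1 := by
  obtain ⟨c₀, hc₀⟩ := IsAlgClosed.exists_pow_nat_eq w₀⁻¹ (n := 3) (by norm_num)
  refine ⟨{w | w ≠ 0 ∧ w₀ / w ∈ Complex.slitPlane}, ?_, ⟨h₀, ?_⟩,
    fun w => c₀ * Complex.exp (Complex.log (w₀ / w) / 3), ?_, ?_⟩
  · have h : ContinuousOn (fun w : ℂ => w₀ / w) {w | w ≠ 0} :=
      continuousOn_const.div continuousOn_id fun w hw => hw
    exact h.isOpen_inter_preimage isOpen_ne Complex.isOpen_slitPlane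
  · rw [div_self h₀]
    exact Complex.one_mem_slitPlane
  · intro w hw
    have h1 : ContDiffAt ℂ ∞ (fun w => w₀ / w) w := contDiffAt_const.div contDiffAt_id hw.1
    have h2 : ContDiffAt ℂ ∞ (fun w => Complex.log (w₀ / w)) w :=
      (Complex.contDiffAt_log hw.2).comp w h1
    exact ((contDiffAt_const.mul (h2.div_const 3).cexp).restrict_scalars ℝ).contDiffWithinAt
  · intro w hw
    have hw0 : w ≠ 0 := hw.1
    rw [mul_pow, hc₀, ← Complex.exp_nat_mul]
    rw [show ((3 : ℕ) : ℂ) * (Complex.log (w₀ / w) / 3) = Complex.log (w₀ / w) by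
      push_cast; ring, Complex.exp_log (div_ne_zero h₀ hw0)]
    field_simp

/-- Scale `v` by the cube root `k w` to fix the phase, then divide by the norm `ρ⁻¹` of the result;
the second step only multiplies the determinant by `ρ ^ 3 > 0`. It is applied with `w` the
determinant of a lift and `v` the value of that lift. -/
theorem exists_contDiffOn_normalization {w₀ : ℂ} (h₀ : w₀ ≠ 0) :
    ∃ S : Set ℂ, IsOpen S ∧ w₀ ∈ S ∧ ∃ N : ℂ × C3 → C3, ContDiffOn ℝ ∞ N (S ×ˢ {v | v ≠ 0}) ∧
      ∀ w ∈ S, ∀ v : C3, v ≠ 0 → ‖N (w, v)‖ = 1 ∧ ∃ a : ℂ, a ≠ 0 ∧ N (w, v) = a • v ∧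
        IsPosReal (a ^ 3 * w) := by
  obtain ⟨S, hSo, hS, k, hks, hk⟩ := exists_contDiffOn_cubeRoot h₀
  have hk0 : ∀ w ∈ S, k w ≠ 0 := fun w hw h => by simpa [h] using hk w hw
  refine ⟨S, hSo, hS, fun q => ‖k q.1 • q.2‖⁻¹ • k q.1 • q.2, ?_, ?_⟩
  · have h1 : ContDiffOn ℝ ∞ (fun q : ℂ × C3 => k q.1 • q.2) (S ×ˢ {v | v ≠ 0}) :=
      (hks.comp contDiffOn_fst fun q hq => hq.1).smul contDiffOn_snd
    have h2 : ∀ q ∈ S ×ˢ {v : C3 | v ≠ 0}, k q.1 • q.2 ≠ 0 := fun q hq =>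
      smul_ne_zero (hk0 _ hq.1) hq.2
    exact ((h1.norm ℝ h2).inv fun q hq => norm_ne_zero_iff.2 (h2 q hq)).smul h1
  · intro w hw v hv
    have hv0 : k w • v ≠ 0 := smul_ne_zero (hk0 _ hw) hv
    have hρ0 : 0 < ‖k w • v‖⁻¹ := inv_pos.2 (norm_pos_iff.2 hv0)
    set ρ := ‖k w • v‖⁻¹ with hρ
    have hρc : (ρ : ℂ) ≠ 0 := by exact_mod_cast hρ0.ne'
    refine ⟨?_, ρ * k w, mul_ne_zero hρc (hk0 w hw), by rw [mul_smul, Complex.coe_smul], ρ ^ 3,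
      by positivity, ?_⟩
    · rw [norm_smul, Real.norm_of_nonneg hρ0.le, hρ, inv_mul_cancel₀ (norm_ne_zero_iff.2 hv0)]
    · push_cast
      linear_combination (ρ : ℂ) ^ 3 * hk w hw

/-- Unit multiples `c • v` with `c ^ 3 * w` positive differ by cubic roots of unity. -/
theorem exists_cubeRoot_smul_iff {w a : ℂ} {v : C3} (hv : v ≠ 0) (ha0 : a ≠ 0)
    (hn : ‖a • v‖ = 1) (ha : IsPosReal (a ^ 3 * w)) (u : C3) :
    (‖u‖ = 1 ∧ ∃ c : ℂ, u = c • v ∧ IsPosReal (c ^ 3 * w)) ↔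
      ∃ ζ : ℂ, ζ ^ 3 = 1 ∧ u = ζ • a • v := by
  constructor
  · rintro ⟨hu, c, rfl, hc⟩
    refine ⟨c / a, IsPosReal.eq_one_of_norm ?_ ?_, by rw [smul_smul, div_mul_cancel₀ _ ha0]⟩
    · obtain ⟨r, hr, h⟩ := ha
      rw [← isPosReal_real_mul hr, ← h]
      convert hc using 1
      field_simp
    · rw [norm_smul] at hu hn
      have : ‖c‖ = ‖a‖ := mul_right_cancel₀ (norm_ne_zero_iff.2 hv) (hu.trans hn.symm)
      rw [norm_pow, norm_div, this, div_self (norm_ne_zero_iff.2 ha0), one_pow]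
  · rintro ⟨ζ, hζ, rfl⟩
    have hζn : ‖ζ‖ = 1 := Complex.norm_eq_one_of_pow_eq_one hζ (by norm_num)
    refine ⟨by rw [norm_smul, hζn, hn, one_mul], ζ * a, by rw [smul_smul], ?_⟩
    rwa [mul_pow, hζ, one_mul]

section

variable {M : Type*} [TopologicalSpace M] [ChartedSpace ℂ M] {f : M → CP2}

theorem IsPositiveLift.mk_eq {p : M} {u : C3} (h : IsPositiveLift f p u) (hu : u ≠ 0) :
    CP2.mk ⟨u, hu⟩ = f p := by
  obtain ⟨-, c, hc, -⟩ := h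
  refine Eq.trans ?_ (mk_affineLift (mem_affineDomain_chartIndex (f p)))
  exact (CP2.mk_eq_mk _ _).2 ⟨c, hc.symm⟩

/-- Locally, positive lifts are the multiples of a smooth one by cubic roots of unity. -/
theorem exists_local_positiveLift [RiemannSurface M] (hf : IsSmoothImmersion (F := C2) f)
    (hc : ∀ p, ¬ IsComplexPoint f p) (p₀ : M) :
    ∃ U : Set M, IsOpen U ∧ p₀ ∈ U ∧ ∃ σ : M → C3, ContMDiffOn 𝓘(ℝ, ℂ) 𝓘(ℝ, C3) ∞ σ U ∧
      ∀ p ∈ U, ‖σ p‖ = 1 ∧ ∀ u, IsPositiveLift f p u ↔ ∃ ζ : ℂ, ζ ^ 3 = 1 ∧ u = ζ • σ p := by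
  let j := chartIndex (f p₀)
  let x := chartAt ℂ p₀
  have hx : x ∈ atlas ℂ M := chart_mem_atlas ℂ p₀
  let G := affineLift j ∘ f
  let U₀ := x.source ∩ f ⁻¹' affineDomain j
  have hU₀o : IsOpen U₀ := x.open_source.inter (isOpen_preimage_affineDomain hf.1 j)
  have hp₀ : p₀ ∈ U₀ := ⟨mem_chart_source ℂ p₀, mem_affineDomain_chartIndex (f p₀)⟩
  have hGs : ContMDiffOn 𝓘(ℝ, ℂ) 𝓘(ℝ, C3) ∞ G U₀ :=
    (contMDiffOn_affineLift_comp hf.1 j).mono Set.inter_subset_right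
  have hds : ContMDiffOn 𝓘(ℝ, ℂ) 𝓘(ℝ, ℂ) ∞ (jetDetIn x G) U₀ :=
    contMDiffOn_jetDetIn hx (contMDiffOn_affineLift_comp hf.1 j)
      (isOpen_preimage_affineDomain hf.1 j)
  have hG0 : ∀ p, G p ≠ 0 := fun p => affineLift_ne_zero j _
  obtain ⟨S, hSo, hS, N, hNs, hN⟩ := exists_contDiffOn_normalization
    (jetDetIn_ne_zero hf (hc p₀) hx hp₀.1 hp₀.2)
  refine ⟨U₀ ∩ jetDetIn x G ⁻¹' S, hds.continuousOn.isOpen_inter_preimage hU₀o hSo, ⟨hp₀, hS⟩,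
    fun p => N (jetDetIn x G p, G p), ?_, ?_⟩
  · have h1 : ContMDiffOn 𝓘(ℝ, ℂ) 𝓘(ℝ, ℂ × C3) ∞ (fun p => (jetDetIn x G p, G p))
        (U₀ ∩ jetDetIn x G ⁻¹' S) :=
      (hds.mono Set.inter_subset_left).prodMk_space (hGs.mono Set.inter_subset_left)
    exact hNs.contMDiffOn.comp h1 fun p hp => ⟨hp.2, hG0 p⟩
  · intro p hp
    obtain ⟨hn, a, ha0, hNa, ha⟩ := hN _ hp.2 _ (hG0 p)
    refine ⟨hn, fun u => ?_⟩
    rw [isPositiveLift_iff hf.1 hx hp.1.1 hp.1.2]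
    beta_reduce
    rw [hNa]
    exact exists_cubeRoot_smul_iff (hG0 p) ha0 (hNa ▸ hn) ha u

end

/-! ### Smoothness of the Hopf fibration -/

theorem contMDiff_ofAffine (i : Fin 3) :
    ContMDiff 𝓘(ℝ, C2) 𝓘(ℝ, C2) ∞ (ofAffine i) :=
  contMDiffOn_univ.1 (contMDiffOn_symm_of_mem_maximalAtlas
    (IsManifold.subset_maximalAtlas (Set.mem_range_self i) : affineChart i ∈ _))

theorem contDiffAt_homogeneousQuotient (i : Fin 3) {Z : C3} (hZ : Z i ≠ 0) :
    ContDiffAt ℝ ∞ (fun Z : C3 => (WithLp.toLp 2 fun j => Z (i.succAbove j) / Z i : C2)) Z := by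
  refine ContDiffAt.restrict_scalars ℝ (𝕜' := ℂ) ?_
  rw [contDiffAt_euclidean]
  intro j
  have h (k : Fin 3) : ContDiffAt ℂ ∞ (fun Z : C3 => Z k) Z :=
    (EuclideanSpace.proj k : C3 →L[ℂ] ℂ).contDiff.contDiffAt
  exact (h _).div (h i) hZ

/-- Near `u` the map is the affine quotient `Z_j / Z_i`, restricted to the sphere, followed by the
inverse affine chart. -/
theorem contMDiff_hopf : ContMDiff (𝓡 5) 𝓘(ℝ, C2) ∞ hopf := by
  intro u
  set i := chartIndex (hopf u)
  have hu : (u : C3) i ≠ 0 := mem_affineDomain_chartIndex (hopf u)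
  have h1 : ContMDiffAt (𝓡 5) 𝓘(ℝ, C3) ∞ (Subtype.val : S5 → C3) u := contMDiff_coe_sphere u
  have h2 := (contMDiff_ofAffine i).contMDiffAt.comp u
    ((contDiffAt_homogeneousQuotient i hu).contMDiffAt.comp u h1)
  refine h2.congr_of_eventuallyEq ?_
  have ho : IsOpen {v : S5 | (v : C3) i ≠ 0} := isOpen_ne_fun (by fun_prop) continuous_const
  filter_upwards [ho.mem_nhds hu] with v hv
  exact ((affineChart i).left_inv (show hopf v ∈ affineDomain i from hv)).symm

/-- A smooth lift of an immersion is automatically an immersion: `dh` factors through the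
differential of the lift, so injectivity of `dh` passes to it. -/
theorem exists_isGlobalLift {N : Type*} [TopologicalSpace N] [ChartedSpace ℂ N]
    [IsManifold 𝓘(ℝ, ℂ) ∞ N] {h : N → CP2} (hh : IsSmoothImmersion (F := C2) h) {F : N → C3}
    (hF : ContMDiff 𝓘(ℝ, ℂ) 𝓘(ℝ, C3) ∞ F) (hn : ∀ p, ‖F p‖ = 1)
    (hmk : ∀ p (h0 : F p ≠ 0), CP2.mk ⟨F p, h0⟩ = h p) : ∃ F' : N → S5, IsGlobalLift h F' := by
  have hs : ∀ p, F p ∈ Metric.sphere (0 : C3) 1 := fun p => by simpa using hn p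
  have hc : ContMDiff 𝓘(ℝ, ℂ) (𝓡 5) ∞ (Set.codRestrict F (Metric.sphere (0 : C3) 1) hs) :=
    hF.codRestrict_sphere hs
  have hcomp : hopf ∘ Set.codRestrict F (Metric.sphere (0 : C3) 1) hs = h :=
    funext fun p => hmk p _
  refine ⟨Set.codRestrict F (Metric.sphere (0 : C3) 1) hs, ⟨hc, fun p => ?_⟩, hcomp⟩
  have h1 := hh.2 p
  rw [← hcomp, mfderiv_comp p ((contMDiff_hopf _).mdifferentiableAt (by simp))
    ((hc p).mdifferentiableAt (by simp))] at h1
  exact Function.Injective.of_comp h1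

/-! ### The covering by positive lifts -/

section

variable {M : Type*} [TopologicalSpace M] [ChartedSpace ℂ M]

/-- The pairs of a point and a positive lift at this point. -/
def PositiveLifts (f : M → CP2) : Type _ := {e : M × C3 // IsPositiveLift f e.1 e.2}

namespace PositiveLifts

variable {f : M → CP2}

instance : TopologicalSpace (PositiveLifts f) := inferInstanceAs (TopologicalSpace (Subtype _))

instance [T2Space M] : T2Space (PositiveLifts f) := inferInstanceAs (T2Space (Subtype _))

/-- The projection to the surface. -/
def proj (e : PositiveLifts f) : M := e.1.1

/-- The tautological lift. -/
def vec (e : PositiveLifts f) : C3 := e.1.2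

theorem isPositiveLift (e : PositiveLifts f) : IsPositiveLift f e.proj e.vec := e.2

theorem continuous_val : Continuous (Subtype.val : PositiveLifts f → M × C3) :=
  continuous_subtype_val

theorem continuous_proj : Continuous (proj : PositiveLifts f → M) :=
  continuous_fst.comp continuous_val

theorem continuous_vec : Continuous (vec : PositiveLifts f → C3) :=
  continuous_snd.comp continuous_val

end PositiveLifts

/-- A smooth section of the positive lifts over an open set `U`, together with a description of all
positive lifts over `U` as its multiples. -/
structure IsPositiveFrame (f : M → CP2) (U : Set M) (σ : M → C3) : Prop where
  isOpen : IsOpen U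
  contMDiffOn : ContMDiffOn 𝓘(ℝ, ℂ) 𝓘(ℝ, C3) ∞ σ U
  norm_eq : ∀ p ∈ U, ‖σ p‖ = 1
  iff : ∀ p ∈ U, ∀ u, IsPositiveLift f p u ↔ ∃ ζ : ℂ, ζ ^ 3 = 1 ∧ u = ζ • σ p

namespace IsPositiveFrame

variable {f : M → CP2} {U : Set M} {σ : M → C3}

/-- Rotating a frame by a root of unity makes it pass through any prescribed positive lift at a
point. -/
theorem smul (h : IsPositiveFrame f U σ) {ζ : ℂ} (hζ : ζ ^ 3 = 1) :
    IsPositiveFrame f U (ζ • σ) where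
  isOpen := h.isOpen
  contMDiffOn := (contDiff_const_smul ζ).contMDiff.comp_contMDiffOn h.contMDiffOn
  norm_eq p hp := by
    rw [Pi.smul_apply, norm_smul, Complex.norm_eq_one_of_pow_eq_one hζ (by norm_num),
      h.norm_eq p hp, one_mul]
  iff p hp u := by
    have hζ0 : ζ ≠ 0 := by rintro rfl; norm_num at hζ
    rw [h.iff p hp]
    constructor
    · rintro ⟨ξ, hξ, rfl⟩
      refine ⟨ξ / ζ, by rw [div_pow, hξ, hζ, div_one], ?_⟩
      rw [Pi.smul_apply, smul_smul, div_mul_cancel₀ _ hζ0]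
    · rintro ⟨ξ, hξ, rfl⟩
      exact ⟨ξ * ζ, by rw [mul_pow, hξ, hζ, mul_one], by rw [Pi.smul_apply, smul_smul]⟩

theorem isPositiveLift (h : IsPositiveFrame f U σ) {p : M} (hp : p ∈ U) :
    IsPositiveLift f p (σ p) :=
  (h.iff p hp _).2 ⟨1, one_pow _, (one_smul _ _).symm⟩

/-- The inner product with the frame recovers the root of unity, and so serves as a continuous fibre
coordinate. -/
theorem inner_smul_self (h : IsPositiveFrame f U σ) {p : M} (hp : p ∈ U) (ζ : ℂ) :
    inner ℂ (σ p) (ζ • σ p) = ζ := by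
  rw [inner_smul_right, inner_self_eq_norm_sq_to_K, h.norm_eq p hp]
  simp

theorem inner_pow (h : IsPositiveFrame f U σ) {p : M} (hp : p ∈ U) {u : C3}
    (hu : IsPositiveLift f p u) : inner ℂ (σ p) u ^ 3 = 1 := by
  obtain ⟨ζ, hζ, rfl⟩ := (h.iff p hp u).1 hu
  rwa [h.inner_smul_self hp]

theorem inner_smul_eq (h : IsPositiveFrame f U σ) {p : M} (hp : p ∈ U) {u : C3}
    (hu : IsPositiveLift f p u) : (inner ℂ (σ p) u : ℂ) • σ p = u := by
  obtain ⟨ζ, hζ, rfl⟩ := (h.iff p hp u).1 hu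
  rw [h.inner_smul_self hp]

theorem continuousOn (h : IsPositiveFrame f U σ) : ContinuousOn σ U := h.contMDiffOn.continuousOn

end IsPositiveFrame

/-- The cubic roots of unity. -/
abbrev CubeRoots : Type := {ζ : ℂ // ζ ∈ Polynomial.nthRootsFinset 3 (1 : ℂ)}

theorem mem_cubeRoots {ζ : ℂ} : ζ ∈ Polynomial.nthRootsFinset 3 (1 : ℂ) ↔ ζ ^ 3 = 1 :=
  Polynomial.mem_nthRootsFinset (by norm_num) 1

theorem card_cubeRoots : Nat.card CubeRoots = 3 := by
  rw [Nat.card_eq_fintype_card, Fintype.card_coe]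
  exact (Complex.isPrimitiveRoot_exp 3 (by norm_num)).card_nthRootsFinset

/-! ### Local triviality and the number of points in fibres -/

namespace PositiveLifts

variable {f : M → CP2}

/-- The trivialization over `U` is `(p, u) ↦ (p, ⟨σ p, u⟩)`, with inverse `(p, ζ) ↦ (p, ζ • σ p)`.
-/
theorem isEvenlyCovered {U : Set M} {σ : M → C3} (h : IsPositiveFrame f U σ) {p : M}
    (hp : p ∈ U) : IsEvenlyCovered (proj : PositiveLifts f → M) p CubeRoots := by
  refine ⟨inferInstance, U, hp, h.isOpen, h.isOpen.preimage continuous_proj, ?_⟩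
  have hσ : Continuous fun q : U => σ q := continuousOn_iff_continuous_domRestrict.1 h.continuousOn
  have hproj : Continuous fun e : (proj : PositiveLifts f → M) ⁻¹' U => (⟨proj e.1, e.2⟩ : U) :=
    (continuous_proj.comp continuous_subtype_val).subtype_mk _
  refine ⟨{
    toFun := fun e => (⟨proj e.1, e.2⟩, ⟨inner ℂ (σ (proj e.1)) (vec e.1),
      mem_cubeRoots.2 (h.inner_pow e.2 e.1.isPositiveLift)⟩)
    invFun := fun q => ⟨⟨(q.1, (q.2 : ℂ) • σ q.1),
      (h.iff _ q.1.2 _).2 ⟨q.2, mem_cubeRoots.1 q.2.2, rfl⟩⟩, q.1.2⟩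
    left_inv := ?_
    right_inv := ?_
    continuous_toFun := ?_
    continuous_invFun := ?_ }, fun e => rfl⟩
  · intro e
    exact Subtype.ext (Subtype.ext (Prod.ext rfl (h.inner_smul_eq e.2 e.1.isPositiveLift)))
  · intro q
    exact Prod.ext rfl (Subtype.ext (h.inner_smul_self q.1.2 _))
  · refine hproj.prodMk (Continuous.subtype_mk ?_ _)
    exact (hσ.comp hproj).inner (continuous_vec.comp continuous_subtype_val)
  · refine Continuous.subtype_mk (Continuous.subtype_mk ?_ _) _
    exact (continuous_subtype_val.comp continuous_fst).prodMk
      ((continuous_subtype_val.comp continuous_snd).smul (hσ.comp continuous_fst))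

theorem ncard_fiber {U : Set M} {σ : M → C3} (h : IsPositiveFrame f U σ) {p : M}
    (hp : p ∈ U) : ((proj : PositiveLifts f → M) ⁻¹' {p}).ncard = 3 := by
  rw [← Nat.card_coe_set_eq, ← Nat.card_congr (isEvenlyCovered h hp).fiberHomeomorph.toEquiv,
    card_cubeRoots]

/-- Near a point, the tautological lift factors through a smooth lift on the surface. -/
theorem eventually_vec_eq {U : Set M} {σ : M → C3} (h : IsPositiveFrame f U σ)
    {e : PositiveLifts f} (he : e.proj ∈ U) (hσ : σ e.proj = e.vec) :
    ∀ᶠ e' in 𝓝 e, e'.vec = σ e'.proj := by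
  have hU : ∀ᶠ e' : PositiveLifts f in 𝓝 e, e'.proj ∈ U :=
    continuous_proj.continuousAt.eventually (h.isOpen.mem_nhds he)
  have hc : ContinuousAt (fun e' : PositiveLifts f => (inner ℂ (σ e'.proj) e'.vec : ℂ)) e :=
    ContinuousAt.inner (𝕜 := ℂ) (ContinuousAt.comp (f := proj) (g := σ)
      (h.continuousOn.continuousAt (h.isOpen.mem_nhds he)) continuous_proj.continuousAt)
      continuous_vec.continuousAt
  have h1 : (inner ℂ (σ e.proj) e.vec : ℂ) = 1 := by
    have := h.inner_smul_self he 1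
    rw [one_smul] at this
    rwa [← hσ]
  -- The other two roots form a finite, hence closed, set. The inner product equals `1` at `e`, so
  -- it avoids `T` nearby; being a cubic root of unity, it stays equal to `1`.
  set T : Set ℂ := ↑((Polynomial.nthRootsFinset 3 (1 : ℂ)).erase 1) with hT
  have hTo : IsOpen Tᶜ := (Finset.isClosed _).isOpen_compl
  have h2 := hc.eventually (hTo.mem_nhds (by beta_reduce; rw [h1]; simp [hT]))
  filter_upwards [hU, h2] with e' he' h2'
  have h3 : (inner ℂ (σ e'.proj) e'.vec : ℂ) = 1 := by
    by_contra hne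
    exact h2' (by simpa [hT, hne] using mem_cubeRoots.2 (h.inner_pow he' e'.isPositiveLift))
  rw [← h.inner_smul_eq he' e'.isPositiveLift, h3, one_smul]

/-- The vectors over `p` that belong to a set of positive lifts. -/
def fiberSet (A : Set (PositiveLifts f)) (p : M) : Set C3 :=
  {u | ∃ h : IsPositiveLift f p u, (⟨(p, u), h⟩ : PositiveLifts f) ∈ A}

theorem eventually_mem_fiberSet {U : Set M} {σ : M → C3} (h : IsPositiveFrame f U σ) {p : M}
    (hp : p ∈ U) {A : Set (PositiveLifts f)} (hA : IsOpen A) (hσ : σ p ∈ fiberSet A p) :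
    ∀ᶠ q in 𝓝 p, σ q ∈ fiberSet A q := by
  obtain ⟨O, hO, rfl⟩ := isOpen_induced_iff.1 hA
  obtain ⟨_, hσO⟩ := hσ
  have hc : ContinuousAt (fun q => (q, σ q)) p :=
    continuousAt_id.prodMk (h.continuousOn.continuousAt (h.isOpen.mem_nhds hp))
  filter_upwards [h.isOpen.mem_nhds hp, hc.eventually (hO.mem_nhds hσO)] with q hq hqO
  exact ⟨h.isPositiveLift hq, hqO⟩

theorem mem_fiberSet_compl {A : Set (PositiveLifts f)} {p : M} {u : C3}
    (hu : IsPositiveLift f p u) : u ∈ fiberSet Aᶜ p ↔ u ∉ fiberSet A p :=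
  ⟨fun ⟨_, h⟩ ⟨_, h'⟩ => h h', fun h => ⟨hu, fun h' => h ⟨hu, h'⟩⟩⟩

/-- The frame identifies every fibre over `U` with the fixed set `CubeRoots`, so counts at different
points can be compared. -/
theorem ncard_fiberSet {U : Set M} {σ : M → C3} (h : IsPositiveFrame f U σ) {p : M}
    (hp : p ∈ U) (A : Set (PositiveLifts f)) :
    (fiberSet A p).ncard = {ζ : CubeRoots | (ζ : ℂ) • σ p ∈ fiberSet A p}.ncard := by
  have hinj : Function.Injective fun ζ : CubeRoots => (ζ : ℂ) • σ p := by
    intro ζ ξ hζ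
    have := congrArg (inner ℂ (σ p)) hζ
    simp only [h.inner_smul_self hp] at this
    exact Subtype.ext this
  rw [← Set.ncard_image_of_injective _ hinj]
  congr 1
  ext u
  constructor
  · rintro ⟨hu, huA⟩
    obtain ⟨ζ, hζ, rfl⟩ := (h.iff p hp u).1 hu
    exact ⟨⟨ζ, mem_cubeRoots.2 hζ⟩, ⟨hu, huA⟩, rfl⟩
  · rintro ⟨ζ, hζ, rfl⟩
    exact hζ

theorem ncard_fiberSet_add_compl {U : Set M} {σ : M → C3} (h : IsPositiveFrame f U σ) {p : M}
    (hp : p ∈ U) (A : Set (PositiveLifts f)) :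
    (fiberSet A p).ncard + (fiberSet Aᶜ p).ncard = 3 := by
  rw [ncard_fiberSet h hp, ncard_fiberSet h hp]
  refine Eq.trans ?_ ((Set.ncard_add_ncard_compl
    {ζ : CubeRoots | (ζ : ℂ) • σ p ∈ fiberSet A p}).trans card_cubeRoots)
  congr 2
  ext ζ
  exact mem_fiberSet_compl ((h.iff p hp _).2 ⟨ζ, mem_cubeRoots.1 ζ.2, rfl⟩)

/-- Each of the three local sheets `ζ • σ` stays in `A` or stays out of `A` near `p`, since both `A`
and its complement are open. -/
theorem eventually_ncard_fiberSet_eq {U : Set M} {σ : M → C3} (h : IsPositiveFrame f U σ) {p : M}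
    (hp : p ∈ U) {A : Set (PositiveLifts f)} (hA : IsClopen A) :
    ∀ᶠ q in 𝓝 p, (fiberSet A q).ncard = (fiberSet A p).ncard := by
  have key (ζ : CubeRoots) : ∀ᶠ q in 𝓝 p,
      ((ζ : ℂ) • σ q ∈ fiberSet A q ↔ (ζ : ℂ) • σ p ∈ fiberSet A p) := by
    have hζ := h.smul (mem_cubeRoots.1 ζ.2)
    by_cases hm : (ζ : ℂ) • σ p ∈ fiberSet A p
    · filter_upwards [eventually_mem_fiberSet hζ hp hA.isOpen hm] with q hq
      exact iff_of_true hq hm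
    · filter_upwards [h.isOpen.mem_nhds hp, eventually_mem_fiberSet hζ hp hA.compl.isOpen
        ((mem_fiberSet_compl (hζ.isPositiveLift hp)).2 hm)] with q hqU hq
      exact iff_of_false ((mem_fiberSet_compl (hζ.isPositiveLift hqU)).1 hq) hm
  filter_upwards [h.isOpen.mem_nhds hp, Filter.eventually_all.2 key] with q hq hk
  rw [ncard_fiberSet h hp, ncard_fiberSet h hq]
  simp only [hk]

end PositiveLifts

end

/-! ### Connectedness of the covering and the conclusion -/

section

variable {M : Type u} [TopologicalSpace M] [ChartedSpace ℂ M] [RiemannSurface M] {f : M → CP2}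

theorem exists_isPositiveFrame (hf : IsSmoothImmersion (F := C2) f)
    (hc : ∀ p, ¬ IsComplexPoint f p) (p : M) : ∃ U σ, p ∈ U ∧ IsPositiveFrame f U σ := by
  obtain ⟨U, hU, hp, σ, hσ, h⟩ := exists_local_positiveLift hf hc p
  exact ⟨U, σ, hp, hU, hσ, fun q hq => (h q hq).1, fun q hq => (h q hq).2⟩

theorem exists_isPositiveFrame_eq (hf : IsSmoothImmersion (F := C2) f)
    (hc : ∀ p, ¬ IsComplexPoint f p) {p : M} {u : C3} (hu : IsPositiveLift f p u) :
    ∃ U σ, p ∈ U ∧ IsPositiveFrame f U σ ∧ σ p = u := by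
  obtain ⟨U, σ, hp, h⟩ := exists_isPositiveFrame hf hc p
  obtain ⟨ζ, hζ, rfl⟩ := (h.iff p hp u).1 hu
  exact ⟨U, ζ • σ, hp, h.smul hζ, rfl⟩

namespace PositiveLifts

/-- An open set of positive lifts with one element in each fibre gives a global lift. -/
theorem exists_isGlobalLift_of_ncard_eq_one (hf : IsSmoothImmersion (F := C2) f)
    (hc : ∀ p, ¬ IsComplexPoint f p) {A : Set (PositiveLifts f)} (hA : IsOpen A)
    (h1 : ∀ p, (fiberSet A p).ncard = 1) : ∃ F : M → S5, IsGlobalLift f F := by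
  choose F hF using fun p => Set.ncard_eq_one.1 (h1 p)
  have hFA (p : M) : F p ∈ fiberSet A p := by rw [hF p]; rfl
  have hFP (p : M) : IsPositiveLift f p (F p) := (hFA p).1
  refine exists_isGlobalLift hf (F := F) (fun p => ?_) (fun p => (hFP p).1)
    fun p h0 => (hFP p).mk_eq h0
  obtain ⟨U, σ, hp, h, hσ⟩ := exists_isPositiveFrame_eq hf hc (hFP p)
  refine (h.contMDiffOn.contMDiffAt (h.isOpen.mem_nhds hp)).congr_of_eventuallyEq ?_
  filter_upwards [eventually_mem_fiberSet h hp hA (hσ ▸ hFA p)] with q hq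
  rw [hF q] at hq
  exact hq.symm

/-- A clopen set has a constant number of points per fibre, and this number and that of its
complement add up to the odd number 3. Unless the set is trivial, it or its complement has exactly
one point in each fibre, which would be a global lift. -/
theorem connectedSpace (hf : IsSmoothImmersion (F := C2) f)
    (hc : ∀ p, ¬ IsComplexPoint f p) (hno : ¬ ∃ F : M → S5, IsGlobalLift f F) :
    ConnectedSpace (PositiveLifts f) := by
  have hne : Nonempty (PositiveLifts f) := by
    obtain ⟨p⟩ := (inferInstance : Nonempty M)
    obtain ⟨U, σ, hp, h⟩ := exists_isPositiveFrame hf hc p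
    exact ⟨⟨(p, σ p), h.isPositiveLift hp⟩⟩
  have hpre : PreconnectedSpace (PositiveLifts f) := by
    refine preconnectedSpace_iff_clopen.2 fun A hA => ?_
    have hloc : IsLocallyConstant fun p => (fiberSet A p).ncard := by
      rw [IsLocallyConstant.iff_eventually_eq]
      intro p
      obtain ⟨U, σ, hp, h⟩ := exists_isPositiveFrame hf hc p
      exact eventually_ncard_fiberSet_eq h hp hA
    have hadd (p : M) : (fiberSet A p).ncard + (fiberSet Aᶜ p).ncard = 3 := by
      obtain ⟨U, σ, hp, h⟩ := exists_isPositiveFrame hf hc p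
      exact ncard_fiberSet_add_compl h hp A
    have hempty {B : Set (PositiveLifts f)} (hB : ∀ p, (fiberSet B p).ncard = 0)
        (hB' : ∀ p, (fiberSet B p).Finite) : B = ∅ := by
      refine Set.eq_empty_of_forall_notMem fun e he => ?_
      have h0 := (Set.ncard_eq_zero (hB' e.proj)).1 (hB e.proj)
      have h1 : e.vec ∈ fiberSet B e.proj := ⟨e.isPositiveLift, he⟩
      rw [h0] at h1
      exact h1
    -- Needed because `ncard` also takes the value 0 on infinite sets.
    have hfin (B : Set (PositiveLifts f)) (p : M) : (fiberSet B p).Finite := by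
      obtain ⟨U, σ, hp, h⟩ := exists_isPositiveFrame hf hc p
      refine (Set.finite_range fun ζ : CubeRoots => (ζ : ℂ) • σ p).subset ?_
      rintro u ⟨hu, -⟩
      obtain ⟨ζ, hζ, rfl⟩ := (h.iff p hp u).1 hu
      exact ⟨⟨ζ, mem_cubeRoots.2 hζ⟩, rfl⟩
    obtain ⟨p₀⟩ := (inferInstance : Nonempty M)
    have hconst (p : M) : (fiberSet A p).ncard = (fiberSet A p₀).ncard :=
      hloc.apply_eq_of_preconnectedSpace p p₀
    have hle := hadd p₀
    have hcases : (fiberSet A p₀).ncard = 0 ∨ (fiberSet A p₀).ncard = 1 ∨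
        (fiberSet A p₀).ncard = 2 ∨ (fiberSet A p₀).ncard = 3 := by omega
    rcases hcases with h | h | h | h
    · exact Or.inl (hempty (fun p => (hconst p).trans h) (hfin A))
    · exact absurd (exists_isGlobalLift_of_ncard_eq_one hf hc hA.isOpen
        fun p => (hconst p).trans h) hno
    · refine absurd (exists_isGlobalLift_of_ncard_eq_one hf hc hA.compl.isOpen
        fun p => ?_) hno
      have := hadd p
      rw [hconst p, h] at this
      omega
    · refine Or.inr (Set.compl_empty_iff.1 (hempty (fun p => ?_) (hfin Aᶜ)))
      have := hadd p
      rw [hconst p, h] at this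
      omega
  exact { toPreconnectedSpace := hpre, toNonempty := hne }

theorem isCoveringMap_proj (hf : IsSmoothImmersion (F := C2) f)
    (hc : ∀ p, ¬ IsComplexPoint f p) : IsCoveringMap (proj : PositiveLifts f → M) := by
  intro p
  obtain ⟨U, σ, hp, h⟩ := exists_isPositiveFrame hf hc p
  exact (isEvenlyCovered h hp).to_isEvenlyCovered_preimage

end PositiveLifts

end

open PositiveLifts in
theorem mainTheorem4 {M : Type u} [TopologicalSpace M] [ChartedSpace ℂ M] [RiemannSurface M]
    (hM : IsEmpty (M ≃ₜ Metric.sphere (0 : EuclideanSpace ℝ (Fin 3)) 1))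
    (f : M → CP2) (hf : IsSmoothImmersion (F := C2) f) (hc : ∀ p, ¬ IsComplexPoint f p) :
    (∃ F : M → S5, IsGlobalLift f F) ∨
      ((∃ (M' : Type u) (_ : TopologicalSpace M') (_ : ChartedSpace ℂ M') (τ : M' → M),
          RiemannSurface M' ∧ IsThreeFoldCovering τ ∧ IsSmoothImmersion (F := C2) (f ∘ τ) ∧
            ∃ F : M' → S5, IsGlobalLift (f ∘ τ) F) ∧
        ¬ ∃ F : M → S5, IsGlobalLift f F) := by
  by_cases hno : ∃ F : M → S5, IsGlobalLift f F
  · exact Or.inl hno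
  refine Or.inr ⟨?_, hno⟩
  have hcov := isCoveringMap_proj hf hc
  have hτ := hcov.isLocalHomeomorph
  let _ : ChartedSpace ℂ (PositiveLifts f) := hτ.pullbackChartedSpace
  have hmC : IsManifold 𝓘(ℂ) ω (PositiveLifts f) := hτ.isManifold_pullback
  -- The same pulled-back atlas gives the holomorphic structure and the smooth structure used for
  -- immersions.
  have hmR : IsManifold 𝓘(ℝ, ℂ) ∞ (PositiveLifts f) := hτ.isManifold_pullback
  have hconn := connectedSpace hf hc hno
  have hτs : ContMDiff 𝓘(ℝ, ℂ) 𝓘(ℝ, ℂ) ∞ (proj : PositiveLifts f → M) := hτ.contMDiff_pullback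
  have himm : IsSmoothImmersion (F := C2) (f ∘ (proj : PositiveLifts f → M)) := by
    refine ⟨hf.1.comp hτs, fun e => ?_⟩
    rw [mfderiv_comp e ((hf.1 _).mdifferentiableAt (by simp)) ((hτs e).mdifferentiableAt (by simp))]
    exact (hf.2 e.proj).comp (hτ.mfderiv_pullback_injective e)
  refine ⟨PositiveLifts f, inferInstance, inferInstance, proj, { }, ⟨hcov, ?_, fun p => ?_⟩,
    himm, exists_isGlobalLift himm (F := vec) (fun e => ?_) (fun e => e.isPositiveLift.1)
      fun e h0 => e.isPositiveLift.mk_eq h0⟩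
  · exact (hτ.contMDiff_pullback (n := 1)).mdifferentiable (by simp)
  · obtain ⟨U, σ, hp, h⟩ := exists_isPositiveFrame hf hc p
    exact ncard_fiber h hp
  -- The tautological lift is smooth because near `e` it equals `σ ∘ τ` for a smooth frame `σ`
  -- through `e`.
  · obtain ⟨U, σ, hp, h, hσ⟩ := exists_isPositiveFrame_eq hf hc e.isPositiveLift
    exact ((h.contMDiffOn.contMDiffAt (h.isOpen.mem_nhds hp)).comp e
      (hτs e)).congr_of_eventuallyEq (eventually_vec_eq h hp hσ)

end
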